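/- Let $M$ be a von Neumann algebra of type $\mathrm{I}_\infty$ on a complex Hilbert space $H$, that is, $M$ is of type I (every nonzero central projection of $M$ majorizes a nonzero abelian projection) and has no nonzero finite central projection. Let $M'$ be the commutant of $M$, let $Z = M\cap M'$ be its center and let $\tau$ be any faithful normal semi-finite trace on $M$. A linear subspace $D\subseteq H$ is affiliated with $M$ if $u(D)\subseteq D$ for every unitary $u\in M'$; a linear operator $x$ with domain $D(x)\subseteq H$ is affiliated with $M$ if, for every unitary $u\in M'$, $u(D(x))\subseteq D(x)$ and $u x\xi = x u\xi$ for all $\xi\in D(x)$. Let - $S(M)$ be the set of measurable operators: the closed operators $x$ affiliated with $M$ for which there are projections $p_n\in M$ with $p_n\uparrow \mathbf 1$, $p_n(H)\subseteq D(x)$ and $\mathbf 1-p_n$ finite in $M$ for all $n$; - $S(M,\tau)$ be the set of $\tau$-measurable operators: the closed operators $x$ affiliated with $M$ such that for every $\varepsilon>0$ there is a projection $p\in M$ with $p(H)\subseteq D(x)$ and $\tau(\mathbf 1-p)<\varepsilon$; - $S_0(M,\tau)$ be the set of $\tau$-compact operators: those $x\in S(M,\tau)$ such that for every $\varepsilon>0$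 there is a projection $p\in M$ with $\tau(\mathbf 1-p)<\infty$, $xp\in M$ and $\|xp\|<\varepsilon$. These are algebras under strong addition and strong multiplication (the closures of the algebraic sum and product); the center of such an algebra is the set of its elements that commute with all its elements under strong multiplication. Then: a) the centers of the algebras $S(M)$ and $S(M,\tau)$ both coincide with $Z$ (bounded operators being regarded as everywhere defined operators on $H$); b) the center of the algebra $S_0(M,\tau)$ is trivial, i.e. $Z(S_0(M,\tau))=\{0\}$. -/

import Mathlib

open Filter Topology
open scoped ENNReal NNReal

namespace VonNeumannAlgebra

variable {H : Type*} [NormedAddCommGroup H] [InnerProductSpace ℂ H] [CompleteSpace H]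

/-! ### Projections and types -/

/-- `p` is a projection of `M`: `p ∈ M` and `p = p* = p²`. -/
def IsProj (M : VonNeumannAlgebra H) (p : H →L[ℂ] H) : Prop :=
  p ∈ M ∧ IsStarProjection p

/-- The centre `Z = M ∩ M'` of `M`. -/
def centre (M : VonNeumannAlgebra H) : Set (H →L[ℂ] H) :=
  {a | a ∈ M ∧ a ∈ M.commutant}

/-- Murray-von Neumann equivalence in `M`: `p = v* v` and `q = v v*` for some `v ∈ M`. -/
def MvNEquiv (M : VonNeumannAlgebra H) (p q : H →L[ℂ] H) : Prop :=
  ∃ v ∈ M, star v * v = p ∧ v * star v = q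

/-- `p` is a finite projection of `M`: it is not equivalent to a proper subprojection. -/
def IsFiniteProj (M : VonNeumannAlgebra H) (p : H →L[ℂ] H) : Prop :=
  M.IsProj p ∧ ∀ q, M.IsProj q → q ≤ p → M.MvNEquiv p q → q = p

/-- `e` is an abelian projection of `M`: the algebra `e M e` is commutative. -/
def IsAbelianProj (M : VonNeumannAlgebra H) (e : H →L[ℂ] H) : Prop :=
  M.IsProj e ∧ ∀ x ∈ M, ∀ y ∈ M, (e * x * e) * (e * y * e) = (e * y * e) * (e * x * e)

/-- `M` is of type I: every nonzero central projection majorizes a nonzero abelian projection. -/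
def IsTypeI (M : VonNeumannAlgebra H) : Prop :=
  ∀ z, M.IsProj z → z ∈ M.centre → z ≠ 0 → ∃ e, M.IsAbelianProj e ∧ e ≠ 0 ∧ e ≤ z

/-- `M` is of type I_∞: it is of type I and properly infinite, that is, it has no nonzero finite
central projection. -/
def IsTypeIInfty (M : VonNeumannAlgebra H) : Prop :=
  M.IsTypeI ∧ ∀ z, z ∈ M.centre → M.IsFiniteProj z → z = 0

/-! ### Traces -/

/-- The positive cone `M₊`. -/
def posCone (M : VonNeumannAlgebra H) : Set (H →L[ℂ] H) :=
  {x | x ∈ M ∧ 0 ≤ x}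

/-- `τ`, restricted to `M₊`, is a faithful normal semi-finite trace `M₊ → [0, ∞]`. The values of
`τ` outside `M₊` play no role. -/
structure IsFNSTrace (M : VonNeumannAlgebra H) (τ : (H →L[ℂ] H) → ℝ≥0∞) : Prop where
  map_add : ∀ x ∈ M.posCone, ∀ y ∈ M.posCone, τ (x + y) = τ x + τ y
  map_smul : ∀ (c : ℝ≥0), ∀ x ∈ M.posCone, τ (((c : ℝ) : ℂ) • x) = c * τ x
  tracial : ∀ x ∈ M, τ (star x * x) = τ (x * star x)
  faithful : ∀ x ∈ M.posCone, τ x = 0 → x = 0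
  normal : ∀ D : Set (H →L[ℂ] H), D ⊆ M.posCone → D.Nonempty → DirectedOn (· ≤ ·) D →
    ∀ x ∈ M.posCone, IsLUB D x → IsLUB (τ '' D) (τ x)
  semifinite : ∀ x ∈ M.posCone, x ≠ 0 → ∃ y ∈ M.posCone, y ≠ 0 ∧ y ≤ x ∧ τ y < ∞

/-! ### Unbounded operators -/

/-- A bounded operator, regarded as an (everywhere defined) partially defined operator. -/
def ofBounded (a : H →L[ℂ] H) : H →ₗ.[ℂ] H :=
  (a : H →ₗ[ℂ] H).toPMap ⊤

/-- The algebraic product `x ∘ y`, with its natural domain `{ξ ∈ D(y) | y ξ ∈ D(x)}`. -/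
def algMul (x y : H →ₗ.[ℂ] H) : H →ₗ.[ℂ] H where
  domain := (x.domain.comap y.toFun).map y.domain.subtype
  toFun :=
    { toFun := fun ξ => x ⟨y ⟨ξ, Submodule.map_subtype_le _ _ ξ.2⟩, by
        obtain ⟨η, hη, h⟩ := (Submodule.mem_map).1 ξ.2
        have : (⟨ξ, Submodule.map_subtype_le _ _ ξ.2⟩ : y.domain) = η := Subtype.ext h.symm
        rw [this]; exact hη⟩
      map_add' := fun ξ η => by
        rw [← LinearPMap.map_add]; congr 1; ext1
        exact LinearPMap.map_add y ⟨ξ, Submodule.map_subtype_le _ _ ξ.2⟩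
          ⟨η, Submodule.map_subtype_le _ _ η.2⟩
      map_smul' := fun c ξ => by
        rw [RingHom.id_apply, ← LinearPMap.map_smul]; congr 1; ext1
        exact LinearPMap.map_smul y c ⟨ξ, Submodule.map_subtype_le _ _ ξ.2⟩ }

/-- The strong product of two operators: the closure of the algebraic product. -/
noncomputable def strongMul (x y : H →ₗ.[ℂ] H) : H →ₗ.[ℂ] H :=
  (algMul x y).closure

/-- The linear subspace `D` is affiliated with `M`: it is invariant under the unitaries of `M'`. -/
def SubspaceAffiliated (M : VonNeumannAlgebra H) (D : Submodule ℂ H) : Prop :=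
  ∀ u ∈ M.commutant, u ∈ unitary (H →L[ℂ] H) → ∀ ξ ∈ D, u ξ ∈ D

/-- The operator `x` is affiliated with `M`: for every unitary `u` of `M'` one has
`u D(x) ⊆ D(x)` and `x u ξ = u x ξ` for all `ξ ∈ D(x)`. -/
def Affiliated (M : VonNeumannAlgebra H) (x : H →ₗ.[ℂ] H) : Prop :=
  ∀ u ∈ M.commutant, u ∈ unitary (H →L[ℂ] H) →
    ∀ ξ : x.domain, ∃ h : u (ξ : H) ∈ x.domain, x ⟨u (ξ : H), h⟩ = u (x ξ)

/-- The linear subspace `D` is strongly dense with respect to `M`: it is affiliated with `M`, and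
there are projections `p₀ ≤ p₁ ≤ …` of `M` with supremum `1` such that `p_n(H) ⊆ D` and `1 - p_n`
is finite in `M` for every `n`. -/
def StronglyDense (M : VonNeumannAlgebra H) (D : Submodule ℂ H) : Prop :=
  M.SubspaceAffiliated D ∧ ∃ p : ℕ → H →L[ℂ] H, (∀ n, M.IsProj (p n)) ∧ Monotone p ∧
    IsLUB (Set.range p) 1 ∧ (∀ n ξ, p n ξ ∈ D) ∧ ∀ n, M.IsFiniteProj (1 - p n)

/-- The linear subspace `D` is `τ`-dense: it is affiliated with `M`, and for every `ε > 0` there is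
a projection `p` of `M` with `p(H) ⊆ D` and `τ(1 - p) < ε`. -/
def TraceDense (M : VonNeumannAlgebra H) (τ : (H →L[ℂ] H) → ℝ≥0∞) (D : Submodule ℂ H) : Prop :=
  M.SubspaceAffiliated D ∧ ∀ ε : ℝ, 0 < ε →
    ∃ p, M.IsProj p ∧ (∀ ξ, p ξ ∈ D) ∧ τ (1 - p) < ENNReal.ofReal ε

/-- `S(M)`: the measurable operators with respect to `M`. -/
def measurableOps (M : VonNeumannAlgebra H) : Set (H →ₗ.[ℂ] H) :=
  {x | x.IsClosed ∧ M.Affiliated x ∧ M.StronglyDense x.domain}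

/-- `S(M, τ)`: the `τ`-measurable operators with respect to `M`. -/
def traceMeasurableOps (M : VonNeumannAlgebra H) (τ : (H →L[ℂ] H) → ℝ≥0∞) :
    Set (H →ₗ.[ℂ] H) :=
  {x | x.IsClosed ∧ M.Affiliated x ∧ M.TraceDense τ x.domain}

/-- `S₀(M, τ)`: the `τ`-compact operators, that is, the `x ∈ S(M, τ)` such that for every `ε > 0`
there is a projection `p` of `M` with `τ(1 - p) < ∞`, `x p ∈ M` and `‖x p‖ < ε`. -/
def traceCompactOps (M : VonNeumannAlgebra H) (τ : (H →L[ℂ] H) → ℝ≥0∞) :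
    Set (H →ₗ.[ℂ] H) :=
  {x | x ∈ M.traceMeasurableOps τ ∧ ∀ ε : ℝ, 0 < ε →
    ∃ p, M.IsProj p ∧ τ (1 - p) < ∞ ∧
      ∃ a ∈ M, strongMul x (ofBounded p) = ofBounded a ∧ ‖a‖ < ε}

/-- The centre of an algebra `A` of closed operators whose multiplication is the strong product:
the elements of `A` that commute with every element of `A`. -/
def strongCentre (A : Set (H →ₗ.[ℂ] H)) : Set (H →ₗ.[ℂ] H) :=
  {z | z ∈ A ∧ ∀ x ∈ A, strongMul z x = strongMul x z}

end VonNeumannAlgebra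

/-!
The type I hypothesis plays no role: the only property of `M` that is used is that it has no
nonzero finite central projection.

A bounded operator `z ∈ M'` commutes strongly with every closed densely defined operator `x`
affiliated with `M`, because `x z` is the closure of `z x` (`strongMul_ofBounded_comm`). This gives
the inclusions from right to left, once the domains are known to be dense; for `τ`-dense domains
this is where faithfulness of the trace enters.

Conversely, let `y` be in the centre of one of the three algebras. It commutes with the bounded
operators of the algebra: all of `M` for `S(M)` and `S(M, τ)`, and at least the Hilbert–Schmidt
operators of `M` for `S₀(M, τ)`, whose relative commutant in `M` is the centre `Z` since `τ` is
semi-finite. Hence `c = (1 + y* y)⁻¹`, a corner of the projection onto the graph of `y`, lies in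
`Z`. The domain of `y` contains the range of a projection `p` of `M` with `1 - p` finite, and `y` is
bounded on this range by the closed graph theorem, so that `p (c - δ) p ≥ 0` for some `δ > 0`. As
`1 - p` is finite and majorizes the complement of the central support of `p`, this central support
is `1` (`hasFullCentralSupport_of_isFiniteProj`). Positivity of a central element can be tested on
the range of such a `p` (`HasFullCentralSupport.nonneg`), so `c ≥ δ`, which makes `y` bounded and
hence an element of `Z`.

If `y = z ∈ Z` is moreover `τ`-compact, then for every `ε > 0` there is a `p` with `‖z p‖ < ε` and
`1 - p` of finite trace, hence finite. Testing the positivity of `ε² - z* z` on the range of `p`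
gives `‖z‖ ≤ ε`, so `z = 0`.
-/

namespace VonNeumannAlgebra

/-! ### Graphs and strong products -/

section Graph

variable {H : Type*} [NormedAddCommGroup H] [InnerProductSpace ℂ H]

theorem mem_graph_ofBounded {a : H →L[ℂ] H} {v : H × H} :
    v ∈ (ofBounded a).graph ↔ v.2 = a v.1 := by
  simp [ofBounded, LinearPMap.mem_graph_iff, eq_comm]

theorem ofBounded_injective : Function.Injective (ofBounded : (H →L[ℂ] H) → H →ₗ.[ℂ] H) := by
  intro a b h
  ext ξ
  have : (ξ, a ξ) ∈ (ofBounded b).graph := h ▸ mem_graph_ofBounded.2 rfl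
  exact mem_graph_ofBounded.1 this

theorem ofBounded_zero : ofBounded (0 : H →L[ℂ] H) = 0 := rfl

theorem isClosed_ofBounded (a : H →L[ℂ] H) : (ofBounded a).IsClosed := by
  have : ((ofBounded a).graph : Set (H × H)) = {v | v.2 = a v.1} :=
    Set.ext fun v => mem_graph_ofBounded
  rw [LinearPMap.IsClosed, this]
  exact isClosed_eq continuous_snd (a.continuous.comp continuous_fst)

theorem mem_graph_algMul {x y : H →ₗ.[ℂ] H} {v : H × H} :
    v ∈ (algMul x y).graph ↔ ∃ ζ, (v.1, ζ) ∈ y.graph ∧ (ζ, v.2) ∈ x.graph := by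
  obtain ⟨ξ, η⟩ := v
  constructor
  · intro h
    obtain ⟨⟨ξ', h'⟩, rfl, rfl⟩ := LinearPMap.mem_graph_iff _ |>.1 h
    obtain ⟨⟨_, h₁⟩, h₂, rfl⟩ := Submodule.mem_map.1 h'
    exact ⟨_, y.mem_graph ⟨_, h₁⟩, x.mem_graph ⟨_, h₂⟩⟩
  · rintro ⟨ζ, h₁, h₂⟩
    obtain ⟨⟨ξ', h₁'⟩, rfl, rfl⟩ := LinearPMap.mem_graph_iff _ |>.1 h₁
    obtain ⟨⟨ζ', h₂'⟩, h₃, rfl⟩ := LinearPMap.mem_graph_iff _ |>.1 h₂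
    simp only at h₃
    subst h₃
    have hd : ξ' ∈ (algMul x y).domain := Submodule.mem_map.2 ⟨⟨ξ', h₁'⟩, h₂', rfl⟩
    exact (algMul x y).mem_graph ⟨ξ', hd⟩

theorem mem_graph_algMul_ofBounded {x : H →ₗ.[ℂ] H} {a : H →L[ℂ] H} {v : H × H} :
    v ∈ (algMul x (ofBounded a)).graph ↔ (a v.1, v.2) ∈ x.graph := by
  rw [mem_graph_algMul]
  simp only [mem_graph_ofBounded, exists_eq_left]

theorem mem_graph_ofBounded_algMul {x : H →ₗ.[ℂ] H} {a : H →L[ℂ] H} {v : H × H} :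
    v ∈ (algMul (ofBounded a) x).graph ↔ ∃ ζ, (v.1, ζ) ∈ x.graph ∧ v.2 = a ζ := by
  rw [mem_graph_algMul]
  simp only [mem_graph_ofBounded]

/-- For closed `x` and bounded `a` the algebraic product `x ∘ a` is already closed. -/
theorem isClosed_algMul_ofBounded {x : H →ₗ.[ℂ] H} (hx : x.IsClosed) (a : H →L[ℂ] H) :
    (algMul x (ofBounded a)).IsClosed := by
  have : ((algMul x (ofBounded a)).graph : Set (H × H)) =
      (fun v : H × H => (a v.1, v.2)) ⁻¹' (x.graph : Set (H × H)) :=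
    Set.ext fun v => mem_graph_algMul_ofBounded
  rw [LinearPMap.IsClosed, this]
  exact IsClosed.preimage (by fun_prop) hx

theorem closure_eq_self {x : H →ₗ.[ℂ] H} (hx : x.IsClosed) : x.closure = x :=
  LinearPMap.eq_of_eq_graph <| by
    rw [← hx.isClosable.graph_closure_eq_closure_graph, hx.submodule_topologicalClosure_eq]

theorem strongMul_ofBounded_right {x : H →ₗ.[ℂ] H} (hx : x.IsClosed) (a : H →L[ℂ] H) :
    strongMul x (ofBounded a) = algMul x (ofBounded a) :=
  closure_eq_self (isClosed_algMul_ofBounded hx a)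

theorem strongMul_ofBounded_ofBounded (a b : H →L[ℂ] H) :
    strongMul (ofBounded a) (ofBounded b) = ofBounded (a * b) := by
  rw [strongMul_ofBounded_right (isClosed_ofBounded a)]
  refine LinearPMap.eq_of_eq_graph (Submodule.ext fun v => ?_)
  rw [mem_graph_algMul_ofBounded, mem_graph_ofBounded, mem_graph_ofBounded]
  rfl

/-- The bounded operator `a` maps `D(x)` to itself and satisfies `x a ξ = a x ξ` on `D(x)`;
equivalently, `a ⊕ a` leaves the graph of `x` invariant. -/
def GraphInvariant (a : H →L[ℂ] H) (x : H →ₗ.[ℂ] H) : Prop :=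
  ∀ ξ η, (ξ, η) ∈ x.graph → (a ξ, a η) ∈ x.graph

theorem graphInvariant_of_strongMul_comm {x : H →ₗ.[ℂ] H} (hx : x.IsClosed) {a : H →L[ℂ] H}
    (h : strongMul x (ofBounded a) = strongMul (ofBounded a) x) : GraphInvariant a x := by
  intro ξ η hξ
  have h₁ : (ξ, a η) ∈ (algMul (ofBounded a) x).graph :=
    mem_graph_ofBounded_algMul.2 ⟨η, hξ, rfl⟩
  have h₂ := LinearPMap.le_graph_of_le (LinearPMap.le_closure _) h₁
  change _ ∈ (strongMul (ofBounded a) x).graph at h₂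
  rw [← h, strongMul_ofBounded_right hx] at h₂
  exact mem_graph_algMul_ofBounded.1 h₂

theorem graphInvariant_ofBounded {a b : H →L[ℂ] H} :
    GraphInvariant a (ofBounded b) ↔ b * a = a * b := by
  simp only [GraphInvariant, mem_graph_ofBounded, forall_eq]
  rw [ContinuousLinearMap.ext_iff]
  simp [eq_comm]

theorem inner_self_eq_ofReal (ξ : H) : inner ℂ ξ ξ = ((‖ξ‖ ^ 2 : ℝ) : ℂ) := by
  rw [inner_self_eq_norm_sq_to_K]
  push_cast
  rfl

end Graph

/-! ### Affiliated operators -/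

variable {H : Type*} [NormedAddCommGroup H] [InnerProductSpace ℂ H] [CompleteSpace H]

/-- A von Neumann algebra is a C*-algebra, hence spanned by its unitaries. -/
theorem exists_sum_unitary_of_mem (N : VonNeumannAlgebra H) {a : H →L[ℂ] H} (ha : a ∈ N) :
    ∃ (u : Fin 4 → H →L[ℂ] H) (c : Fin 4 → ℂ),
      (∀ i, u i ∈ N ∧ u i ∈ unitary (H →L[ℂ] H)) ∧ a = ∑ i, c i • u i := by
  have hcl : _root_.IsClosed (N.toStarSubalgebra : Set (H →L[ℂ] H)) := by
    rw [coe_toStarSubalgebra, ← centralizer_centralizer N]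
    exact Set.isClosed_centralizer _
  let _ := StarSubalgebra.cstarAlgebra N.toStarSubalgebra (h_closed := hcl)
  obtain ⟨u, c, hu, -⟩ :=
    CStarAlgebra.exists_sum_four_unitary (⟨a, ha⟩ : N.toStarSubalgebra)
  refine ⟨fun i => ((u i : N.toStarSubalgebra) : H →L[ℂ] H), c,
    fun i => ⟨(u i : N.toStarSubalgebra).2, ?_, ?_⟩, ?_⟩
  · exact congrArg Subtype.val (u i).2.1
  · exact congrArg Subtype.val (u i).2.2
  · simpa using congrArg (N.toStarSubalgebra.subtype) hu

theorem Affiliated.graphInvariant {M : VonNeumannAlgebra H} {x : H →ₗ.[ℂ] H}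
    (hx : M.Affiliated x) {a : H →L[ℂ] H} (ha : a ∈ M.commutant) : GraphInvariant a x := by
  obtain ⟨u, c, hu, rfl⟩ := exists_sum_unitary_of_mem _ ha
  intro ξ η hξ
  have key : ∀ i, (u i ξ, u i η) ∈ x.graph := fun i => by
    obtain ⟨ξ', rfl, rfl⟩ := LinearPMap.mem_graph_iff _ |>.1 hξ
    obtain ⟨h, h'⟩ := hx (u i) (hu i).1 (hu i).2 ξ'
    rw [← h']
    exact x.mem_graph ⟨_, h⟩
  have := sum_mem fun i (_ : i ∈ Finset.univ) => x.graph.smul_mem (c i) (key i)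
  simpa [Prod.ext_iff, Finset.sum_apply, Prod.fst_sum, Prod.snd_sum] using this

theorem affiliated_ofBounded {M : VonNeumannAlgebra H} {a : H →L[ℂ] H} (ha : a ∈ M) :
    M.Affiliated (ofBounded a) := by
  intro u hu _ ξ
  refine ⟨trivial, ?_⟩
  exact congrArg (fun b : H →L[ℂ] H => b ξ) (mem_commutant_iff.1 hu a ha)

/-! ### Orthogonal projections onto graphs and commutation with `M'` -/

/-- The orthogonal projection onto a closed subspace of the Hilbert sum `H ⊕ H`, transported to the
product `H × H`, which carries the supremum norm and no inner product. -/
theorem exists_proj_prod (L : Submodule ℂ (H × H)) (hL : _root_.IsClosed (L : Set (H × H))) :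
    ∃ P : H × H →L[ℂ] H × H, ∀ v, P v ∈ L ∧ ∀ l ∈ L,
      inner ℂ l.1 (v.1 - (P v).1) + inner ℂ l.2 (v.2 - (P v).2) = 0 := by
  let e := WithLp.prodContinuousLinearEquiv 2 ℂ H H
  let K : Submodule ℂ (WithLp 2 (H × H)) := L.comap e.toLinearMap
  have hK : _root_.IsClosed (K : Set (WithLp 2 (H × H))) := hL.preimage e.continuous
  have : CompleteSpace K := hK.completeSpace_coe
  refine ⟨(e : _ →L[ℂ] H × H) ∘L K.starProjection ∘L (e.symm : H × H →L[ℂ] _), fun v => ⟨?_, ?_⟩⟩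
  · exact K.starProjection_apply_mem (e.symm v)
  · intro l hl
    have hl' : e.symm l ∈ K := hl
    have := K.starProjection_inner_eq_zero (e.symm v) _ hl'
    rw [← inner_conj_symm, map_eq_zero, WithLp.prod_inner_apply] at this
    exact this

/-- If `z ∈ M'`, then `x z` is the closure of `z x` for every closed densely defined `x` affiliated
with `M`: a vector `(ξ, η)` of the graph of `x z` orthogonal to the graph of `z x` is orthogonal to
the image under `1 ⊕ z` of `(z* z ξ, z* η)`, so that `‖z ξ‖² + ‖z* η‖² = 0`. -/
theorem strongMul_ofBounded_comm {M : VonNeumannAlgebra H} {x : H →ₗ.[ℂ] H} (hx : x.IsClosed)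
    (hxM : M.Affiliated x) (hd : x.domainᗮ = ⊥) {z : H →L[ℂ] H} (hz : z ∈ M.commutant) :
    strongMul (ofBounded z) x = strongMul x (ofBounded z) := by
  have hzs : star z ∈ M.commutant := star_mem hz
  have hle : algMul (ofBounded z) x ≤ algMul x (ofBounded z) := by
    refine LinearPMap.le_of_le_graph fun v hv => ?_
    obtain ⟨ζ, hζ, hv2⟩ := mem_graph_ofBounded_algMul.1 hv
    rw [mem_graph_algMul_ofBounded, hv2]
    exact hxM.graphInvariant hz _ _ hζ
  have hcl := isClosed_algMul_ofBounded hx z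
  have hclo : (algMul (ofBounded z) x).IsClosable := hcl.isClosable.leIsClosable hle
  rw [strongMul_ofBounded_right hx]
  refine LinearPMap.eq_of_eq_graph (le_antisymm ?_ ?_)
  · rw [strongMul, ← hclo.graph_closure_eq_closure_graph]
    exact Submodule.topologicalClosure_minimal _ (LinearPMap.le_graph_of_le hle) hcl
  set G := (strongMul (ofBounded z) x).graph with hG
  have hGc : _root_.IsClosed (G : Set (H × H)) := hclo.closure_isClosed
  have hsub : ∀ s t, (s, t) ∈ x.graph → (s, z t) ∈ G := fun s t hst =>
    LinearPMap.le_graph_of_le (LinearPMap.le_closure _)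
      (mem_graph_ofBounded_algMul.2 ⟨t, hst, rfl⟩)
  have hGle : G ≤ (algMul x (ofBounded z)).graph := by
    rw [hG, strongMul, ← hclo.graph_closure_eq_closure_graph]
    exact Submodule.topologicalClosure_minimal _ (LinearPMap.le_graph_of_le hle) hcl
  obtain ⟨P, hP⟩ := exists_proj_prod G hGc
  intro v hv
  obtain ⟨hPv, horth⟩ := hP v
  obtain ⟨⟨ξ, η⟩, hw⟩ : ∃ w, w = v - P v := ⟨_, rfl⟩
  have hξ : v.1 - (P v).1 = ξ := by rw [← Prod.fst_sub, ← hw]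
  have hη : v.2 - (P v).2 = η := by rw [← Prod.snd_sub, ← hw]
  have hwx : (z ξ, η) ∈ x.graph := by
    have : (ξ, η) ∈ (algMul x (ofBounded z)).graph := hw ▸ sub_mem hv (hGle hPv)
    exact mem_graph_algMul_ofBounded.1 this
  simp only [hξ, hη] at horth
  have h₀ := horth _ (hsub _ _ (hxM.graphInvariant hzs _ _ hwx))
  simp only [ContinuousLinearMap.star_eq_adjoint] at h₀
  rw [ContinuousLinearMap.adjoint_inner_left, ← ContinuousLinearMap.adjoint_inner_right z _ η,
    inner_self_eq_ofReal, inner_self_eq_ofReal] at h₀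
  have h₁ : ‖z ξ‖ ^ 2 + ‖ContinuousLinearMap.adjoint z η‖ ^ 2 = 0 := by exact_mod_cast h₀
  -- Now `(0, η)` lies in the graph of `x`, so `η = 0`, and then `ξ` is orthogonal to the domain.
  have hzξ : z ξ = 0 := by
    rw [← norm_eq_zero]; nlinarith [sq_nonneg ‖z ξ‖, sq_nonneg ‖ContinuousLinearMap.adjoint z η‖]
  rw [hzξ] at hwx
  have hη0 : η = 0 := x.graph_fst_eq_zero_snd hwx rfl
  have hξ0 : ξ = 0 := by
    have : ξ ∈ x.domainᗮ := by
      intro s hs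
      have := horth _ (hsub _ _ (x.mem_graph ⟨s, hs⟩))
      simpa [hη0] using this
    rwa [hd, Submodule.mem_bot] at this
  have : v - P v = 0 := by rw [← hw, hη0, hξ0]; rfl
  rw [sub_eq_zero.1 this]
  exact hPv

/-! ### The operator `(1 + x* x)⁻¹` -/

section Graph

variable {H : Type*} [NormedAddCommGroup H] [InnerProductSpace ℂ H]

/-- `c` is the corner `H ⊕ 0 → H ⊕ 0` of the orthogonal projection onto the graph of `x`: for every
`ξ` that projection maps `(ξ, 0)` to a vector `(c ξ, β)`. For closed densely defined `x` this says
`c = (1 + x* x)⁻¹`; phrasing it through the graph avoids the adjoint of `x`. -/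
def IsGraphResolvent (x : H →ₗ.[ℂ] H) (c : H →L[ℂ] H) : Prop :=
  ∀ ξ, ∃ β, (c ξ, β) ∈ x.graph ∧ ∀ s t, (s, t) ∈ x.graph → inner ℂ s (ξ - c ξ) = inner ℂ t β

variable {x : H →ₗ.[ℂ] H} {c : H →L[ℂ] H}

theorem IsGraphResolvent.inner_apply_self (hc : IsGraphResolvent x c) (ξ : H) :
    ∃ β, (c ξ, β) ∈ x.graph ∧ inner ℂ (c ξ) ξ = ((‖c ξ‖ ^ 2 + ‖β‖ ^ 2 : ℝ) : ℂ) := by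
  obtain ⟨β, h₁, h₂⟩ := hc ξ
  refine ⟨β, h₁, ?_⟩
  have := h₂ _ _ h₁
  rw [inner_sub_right, sub_eq_iff_eq_add, inner_self_eq_ofReal,
    inner_self_eq_ofReal] at this
  rw [this]; push_cast; ring

/-- Where `x` is bounded by `C`, the quadratic form of `c = (1 + x* x)⁻¹` is bounded below by
`(1 + C²)⁻¹`; this is the Cauchy–Schwarz inequality for `(ξ, x ξ)` and the projection of `(ξ, 0)`
onto the graph. -/
theorem IsGraphResolvent.le_re_inner (hc : IsGraphResolvent x c) {C : ℝ} {ξ η : H}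
    (h : (ξ, η) ∈ x.graph) (hη : ‖η‖ ≤ C * ‖ξ‖) :
    ‖ξ‖ ^ 2 ≤ (1 + C ^ 2) * (inner ℂ (c ξ) ξ).re := by
  obtain ⟨β, h₁, h₂⟩ := hc ξ
  have e₁ := h₂ _ _ h
  have e₂ := h₂ _ _ h₁
  rw [inner_sub_right, sub_eq_iff_eq_add, inner_self_eq_ofReal] at e₁ e₂
  rw [inner_self_eq_ofReal] at e₂
  have e₃ : (inner ℂ (c ξ) ξ).re = ‖β‖ ^ 2 + ‖c ξ‖ ^ 2 := by
    rw [e₂]; norm_cast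
  have e₄ : ‖ξ‖ ^ 2 ≤ ‖η‖ * ‖β‖ + ‖ξ‖ * ‖c ξ‖ := by
    calc ‖ξ‖ ^ 2 = ‖((‖ξ‖ ^ 2 : ℝ) : ℂ)‖ := by simp
      _ = ‖inner ℂ η β + inner ℂ ξ (c ξ)‖ := congrArg norm e₁
      _ ≤ _ := (norm_add_le _ _).trans (add_le_add (norm_inner_le_norm _ _)
        (norm_inner_le_norm _ _))
  rw [e₃]
  have e₅ : ‖ξ‖ ^ 2 ≤ ‖ξ‖ * (C * ‖β‖ + ‖c ξ‖) := by
    nlinarith [mul_le_mul_of_nonneg_right hη (norm_nonneg β)]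
  rcases (norm_nonneg ξ).eq_or_lt with h0 | h0
  · rw [← h0, zero_pow two_ne_zero]; positivity
  have e₆ : ‖ξ‖ ≤ C * ‖β‖ + ‖c ξ‖ := by
    rw [sq] at e₅; exact le_of_mul_le_mul_left e₅ h0
  calc ‖ξ‖ ^ 2 ≤ (C * ‖β‖ + ‖c ξ‖) ^ 2 := by gcongr
    _ ≤ _ := by nlinarith [sq_nonneg (C * ‖c ξ‖ - ‖β‖)]

theorem IsGraphResolvent.nonneg (hc : IsGraphResolvent x c) : 0 ≤ c := by
  rw [ContinuousLinearMap.nonneg_iff_isPositive, ContinuousLinearMap.isPositive_iff_complex]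
  intro ξ
  obtain ⟨β, -, h⟩ := hc.inner_apply_self ξ
  rw [h]
  simp only [RCLike.re_eq_complex_re, Complex.ofReal_re]
  exact ⟨trivial, by positivity⟩

end Graph

theorem exists_isGraphResolvent {x : H →ₗ.[ℂ] H} (hx : x.IsClosed) :
    ∃ c, IsGraphResolvent x c := by
  obtain ⟨P, hP⟩ := exists_proj_prod x.graph hx
  refine ⟨ContinuousLinearMap.fst ℂ H H ∘L P ∘L ContinuousLinearMap.inl ℂ H H, fun ξ => ?_⟩
  obtain ⟨h₁, h₂⟩ := hP (ξ, 0)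
  refine ⟨(P (ξ, 0)).2, h₁, fun s t hst => ?_⟩
  have := h₂ _ hst
  simp only [zero_sub, inner_neg_right] at this
  exact add_neg_eq_zero.1 this

namespace IsGraphResolvent

variable {x : H →ₗ.[ℂ] H} {c : H →L[ℂ] H}

/-- The vector `(a c ξ, a β) - (c a ξ, β')` of the graph of `x` is orthogonal to itself. -/
theorem commute (hc : IsGraphResolvent x c) {a : H →L[ℂ] H} (ha : GraphInvariant a x)
    (ha' : GraphInvariant (star a) x) : a * c = c * a := by
  ext ξ
  obtain ⟨β, h₁, h₂⟩ := hc ξ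
  obtain ⟨β', h₁', h₂'⟩ := hc (a ξ)
  have h₃ := ha _ _ h₁
  have hs : (a (c ξ) - c (a ξ), a β - β') ∈ x.graph := sub_mem h₃ h₁'
  have e₁ := h₂ _ _ (ha' _ _ hs)
  have e₂ := h₂' _ _ hs
  simp only [ContinuousLinearMap.star_eq_adjoint, ContinuousLinearMap.adjoint_inner_left] at e₁
  have e₃ : inner ℂ (a (c ξ) - c (a ξ)) (a (c ξ) - c (a ξ)) +
      inner ℂ (a β - β') (a β - β') = 0 := by
    have : a (c ξ) - c (a ξ) = (a ξ - c (a ξ)) - a (ξ - c ξ) := by rw [map_sub]; abel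
    nth_rw 2 [this]
    rw [inner_sub_right (a (c ξ) - c (a ξ)), e₁, e₂, inner_sub_right]
    ring
  rw [inner_self_eq_ofReal, inner_self_eq_ofReal] at e₃
  have e₄ : ‖a (c ξ) - c (a ξ)‖ ^ 2 + ‖a β - β'‖ ^ 2 = 0 := by exact_mod_cast e₃
  have : ‖a (c ξ) - c (a ξ)‖ = 0 := by
    nlinarith [sq_nonneg ‖a (c ξ) - c (a ξ)‖, sq_nonneg ‖a β - β'‖]
  exact sub_eq_zero.1 (norm_eq_zero.1 this)

end IsGraphResolvent

/-! ### Central elements and projections with finite complement -/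

theorem isFiniteProj_zero (M : VonNeumannAlgebra H) : M.IsFiniteProj 0 :=
  ⟨⟨zero_mem _, .zero _⟩, fun _ hq hle _ => le_antisymm hle hq.2.nonneg⟩

theorem IsProj.one_sub {M : VonNeumannAlgebra H} {p : H →L[ℂ] H} (hp : M.IsProj p) :
    M.IsProj (1 - p) :=
  ⟨sub_mem (one_mem _) hp.1, hp.2.one_sub⟩

theorem smul_mem (M : VonNeumannAlgebra H) (r : ℂ) {a : H →L[ℂ] H} (ha : a ∈ M) : r • a ∈ M :=
  M.toStarSubalgebra.smul_mem ha r

theorem ofReal_smul_nonneg {r : ℝ} (hr : 0 ≤ r) {a : H →L[ℂ] H} (ha : 0 ≤ a) :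
    0 ≤ (r : ℂ) • a := by
  rw [Complex.coe_smul]
  exact smul_nonneg hr ha

theorem isSelfAdjoint_ofReal_smul_one (r : ℝ) : IsSelfAdjoint ((r : ℂ) • (1 : H →L[ℂ] H)) := by
  simp [IsSelfAdjoint, star_smul]

theorem mul_eq_self_of_star_mul_self_eq {v q : H →L[ℂ] H} (hq : IsStarProjection q)
    (h : star v * v = q) : v * q = v := by
  rw [← sub_eq_zero, ← CStarRing.star_mul_self_eq_zero_iff]
  have e : star (v * q - v) * (v * q - v) =
      q * (star v * v) * q - q * (star v * v) - (star v * v) * q + star v * v := by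
    rw [star_sub, star_mul, hq.isSelfAdjoint.star_eq]; noncomm_ring
  rw [e, h, hq.isIdempotentElem.eq, hq.isIdempotentElem.eq]; abel

/-- A subprojection of a finite projection is finite: an equivalence of `q` with `q' ≤ q` extends,
by the identity on `p - q`, to one of `p` with `q' + (p - q) ≤ p`. -/
theorem IsFiniteProj.of_le {M : VonNeumannAlgebra H} {p q : H →L[ℂ] H} (hp : M.IsFiniteProj p)
    (hq : M.IsProj q) (hqp : q ≤ p) : M.IsFiniteProj q := by
  refine ⟨hq, ?_⟩
  rintro q' hq' hle ⟨v, hv, rfl, rfl⟩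
  set q := star v * v with hqdef
  set q' := v * star v with hqdef'
  have hpq : p * q = q := (hq.2.le_iff_mul_eq_right hp.1.2).1 hqp
  have hqp' : q * p = q := (hq.2.le_iff_mul_eq_left hp.1.2).1 hqp
  have hqq : q * q = q := hq.2.isIdempotentElem
  have hqq' : q * q' = q' := (hq'.2.le_iff_mul_eq_right hq.2).1 hle
  have hq'q : q' * q = q' := (hq'.2.le_iff_mul_eq_left hq.2).1 hle
  have hpp : p * p = p := hp.1.2.isIdempotentElem
  have hvq : v * q = v := mul_eq_self_of_star_mul_self_eq hq.2 rfl
  have hq'v : q' * v = v := by rw [hqdef', mul_assoc]; exact hvq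
  have hqv : q * v = v := by rw [← hq'v, ← mul_assoc, hqq']
  have hpv : p * v = v := by rw [← hqv, ← mul_assoc, hpq]
  have hvp : v * p = v := by rw [← hvq, mul_assoc, hqp']
  have sq : star q = q := hq.2.isSelfAdjoint
  have sp : star p = p := hp.1.2.isSelfAdjoint
  have hqsv : q * star v = star v := by rw [← sq, ← star_mul, hvq]
  have hpsv : p * star v = star v := by rw [← sp, ← star_mul, hvp]
  have hsvq : star v * q = star v := by rw [← sq, ← star_mul, hqv]
  have hsvp : star v * p = star v := by rw [← sp, ← star_mul, hpv]
  have hpq' : p * q' = q' := by rw [← hqq', ← mul_assoc, hpq]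
  have hq'p : q' * p = q' := by rw [← hq'q, mul_assoc, hqp']
  have hproj : IsStarProjection (q' + (p - q)) := by
    refine hq'.2.add ((hq.2.le_iff_sub hp.1.2).1 hqp) ?_
    rw [mul_sub, hq'p, hq'q, sub_self]
  have hmem : M.IsProj (q' + (p - q)) := ⟨add_mem hq'.1 (sub_mem hp.1.1 hq.1), hproj⟩
  have h := hp.2 _ hmem ?_ ?_
  · have : q' - q = 0 := by
      rw [← sub_eq_zero] at h; rw [← h]; abel
    exact sub_eq_zero.1 this
  · rw [hproj.le_iff_mul_eq_right hp.1.2, mul_add, mul_sub, hpq', hpp, hpq]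
  · refine ⟨v + (p - q), add_mem hv (sub_mem hp.1.1 hq.1), ?_, ?_⟩
    · rw [star_add, star_sub, sp, sq]
      simp only [add_mul, mul_add, sub_mul, mul_sub, hpv, hqv, hsvp, hsvq, hpp, hpq, hqp', hqq,
        ← hqdef]
      abel
    · rw [star_add, star_sub, sp, sq]
      simp only [add_mul, mul_add, sub_mul, mul_sub, hvp, hvq, hpsv, hqsv, hpp, hpq, hqp', hqq,
        ← hqdef']
      abel

/-- The projection onto the kernel of `t` lies in every von Neumann algebra containing `t`. -/
theorem exists_ker_proj (t : H →L[ℂ] H) :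
    ∃ k : H →L[ℂ] H, IsStarProjection k ∧ (∀ ξ, k ξ = ξ ↔ t ξ = 0) ∧
      ∀ N : VonNeumannAlgebra H, t ∈ N → k ∈ N := by
  let U : Submodule ℂ H := LinearMap.ker (t : H →ₗ[ℂ] H)
  have hU : _root_.IsClosed (U : Set H) := t.isClosed_ker
  have : CompleteSpace U := hU.completeSpace_coe
  refine ⟨U.starProjection, isStarProjection_starProjection, fun ξ => ?_, fun N ht => ?_⟩
  · rw [Submodule.starProjection_eq_self_iff]; rfl
  · rw [IsStarProjection.mem_iff isStarProjection_starProjection]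
    intro y hy
    rw [Submodule.range_starProjection, Module.End.mem_invtSubmodule]
    intro ξ hξ
    have h₁ : t ξ = 0 := hξ
    have h₂ : t (y ξ) = y (t ξ) :=
      (congrArg (fun b : H →L[ℂ] H => b ξ) (mem_commutant_iff.1 hy t ht))
    change t (y ξ) = 0
    rw [h₂, h₁, map_zero]

/-- The projection `p` has central support `1`: no nonzero central element annihilates it. -/
def HasFullCentralSupport (M : VonNeumannAlgebra H) (p : H →L[ℂ] H) : Prop :=
  ∀ t ∈ M.centre, t * p = 0 → t = 0

/-- If `1 - p` is finite and `M` has no nonzero finite central projection, then `p` has central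
support `1`, because the complement of the central support is a central projection below
`1 - p`. -/
theorem hasFullCentralSupport_of_isFiniteProj {M : VonNeumannAlgebra H}
    (hM : ∀ z, z ∈ M.centre → M.IsFiniteProj z → z = 0) {p : H →L[ℂ] H} (hp : M.IsProj p)
    (hfin : M.IsFiniteProj (1 - p)) : M.HasFullCentralSupport p := by
  rintro t ⟨ht, ht'⟩ htp
  obtain ⟨k, hk, hker, hkmem⟩ := exists_ker_proj t
  have hkp : k * p = p := by
    ext ξ
    exact (hker _).2 (congrArg (fun b : H →L[ℂ] H => b ξ) htp)
  have hpk : p * k = p := by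
    have := congrArg star hkp
    rwa [star_mul, hk.isSelfAdjoint.star_eq, hp.2.isSelfAdjoint.star_eq] at this
  have hk1 : M.IsProj (1 - k) := IsProj.one_sub ⟨hkmem _ ht, hk⟩
  have hle : 1 - k ≤ 1 - p := by
    rw [hk1.2.le_iff_mul_eq_right hp.2.one_sub]
    rw [sub_mul, one_mul, mul_sub, mul_one, hpk, sub_self, sub_zero]
  have h0 := hM (1 - k) ⟨hk1.1, sub_mem (one_mem _) (hkmem _ ht')⟩ (hfin.of_le hk1 hle)
  ext ξ
  refine (hker ξ).1 ?_
  rw [← sub_eq_zero.1 h0]; rfl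

theorem negPart_mem {N : VonNeumannAlgebra H} {q : H →L[ℂ] H} (hq : q ∈ N) : q⁻ ∈ N := by
  rw [← commutant_commutant N, mem_commutant_iff]
  intro g hg
  have : Commute q g := mem_commutant_iff.1 hg q hq
  exact (this.cfcₙ_real _).symm

theorem posPart_mem {N : VonNeumannAlgebra H} {q : H →L[ℂ] H} (hq : q ∈ N) : q⁺ ∈ N := by
  rw [← commutant_commutant N, mem_commutant_iff]
  intro g hg
  have : Commute q g := mem_commutant_iff.1 hg q hq
  exact (this.cfcₙ_real _).symm

theorem apply_eq_zero_of_re_inner_nonpos {s : H →L[ℂ] H} (hs : 0 ≤ s) {ξ : H}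
    (h : (inner ℂ (s ξ) ξ).re ≤ 0) : s ξ = 0 := by
  have hr : CFC.sqrt s * CFC.sqrt s = s := CFC.sqrt_mul_sqrt_self s
  have hsa : ContinuousLinearMap.adjoint (CFC.sqrt s) = CFC.sqrt s :=
    (CFC.sqrt_nonneg s).isSelfAdjoint
  have e : (inner ℂ (s ξ) ξ).re = ‖CFC.sqrt s ξ‖ ^ 2 := by
    nth_rw 1 [← hr]
    rw [mul_apply_eq_comp, ← ContinuousLinearMap.adjoint_inner_right, hsa,
      inner_self_eq_ofReal, Complex.ofReal_re]
  have h0 : CFC.sqrt s ξ = 0 := by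
    rw [← norm_eq_zero]; nlinarith [sq_nonneg ‖CFC.sqrt s ξ‖]
  rw [← hr, mul_apply_eq_comp, h0, map_zero]

/-- Positivity of a central element can be tested on the range of a projection with central
support `1`. -/
theorem HasFullCentralSupport.nonneg {M : VonNeumannAlgebra H} {p q : H →L[ℂ] H}
    (h : M.HasFullCentralSupport p) (hp : M.IsProj p) (hq : q ∈ M.centre) (hqs : IsSelfAdjoint q)
    (hpos : ∀ ξ, p ξ = ξ → 0 ≤ (inner ℂ (q ξ) ξ).re) : 0 ≤ q := by
  have hs : q⁻ ∈ M.centre := ⟨negPart_mem hq.1, negPart_mem hq.2⟩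
  have hsp : q⁻ * p = p * q⁻ := (mem_commutant_iff.1 hs.2 p hp.1).symm
  -- On the range of `q⁻ p` the form of `q` is that of `-q⁻`, so it is both `≥ 0` and `≤ 0`.
  have hqq : q * q⁻ = -(q⁻ * q⁻) := by
    nth_rw 1 [← CFC.posPart_sub_negPart q hqs]
    rw [sub_mul, CFC.posPart_mul_negPart, zero_sub]
  have hss : ∀ ξ, q⁻ (q⁻ (p ξ)) = 0 := fun ξ => by
    refine apply_eq_zero_of_re_inner_nonpos (CFC.negPart_nonneg q) ?_
    have e₁ : p (q⁻ (p ξ)) = q⁻ (p ξ) := by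
      change (p * (q⁻ * p)) ξ = (q⁻ * p) ξ
      rw [hsp, ← mul_assoc, hp.2.isIdempotentElem.eq]
    have e₂ := hpos _ e₁
    have e₃ : q (q⁻ (p ξ)) = -(q⁻ (q⁻ (p ξ))) := congrArg (fun b : H →L[ℂ] H => b (p ξ)) hqq
    rw [e₃, inner_neg_left, Complex.neg_re] at e₂
    linarith
  rw [← CFC.negPart_eq_zero_iff q hqs]
  refine h _ hs ?_
  ext ξ
  change q⁻ (p ξ) = 0
  have hsa : ContinuousLinearMap.adjoint q⁻ = q⁻ := (CFC.negPart_nonneg q).isSelfAdjoint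
  rw [← inner_self_eq_zero (𝕜 := ℂ), ← ContinuousLinearMap.adjoint_inner_left, hsa, hss,
    inner_zero_left]

/-! ### Central operators are bounded -/

/-- The closed graph theorem. -/
theorem exists_eq_ofBounded {x : H →ₗ.[ℂ] H} (hx : x.IsClosed) (hd : x.domain = ⊤) :
    ∃ b : H →L[ℂ] H, x = ofBounded b := by
  let f : H →ₗ[ℂ] H := x.toFun ∘ₗ LinearMap.codRestrict x.domain LinearMap.id (by simp [hd])
  have hf : ∀ v, v ∈ x.graph ↔ v ∈ f.graph := by
    intro v
    rw [LinearMap.mem_graph_iff, LinearPMap.mem_graph_iff]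
    constructor
    · rintro ⟨ξ, h₁, h₂⟩
      rw [← h₂, ← h₁]; rfl
    · intro h
      exact ⟨⟨v.1, by simp [hd]⟩, rfl, h.symm⟩
  have hgr : x.graph = f.graph := Submodule.ext hf
  have hc : Continuous f := f.continuous_of_isClosed_graph (hgr ▸ hx)
  refine ⟨⟨f, hc⟩, LinearPMap.eq_of_eq_graph (Submodule.ext fun v => ?_)⟩
  rw [hf, LinearMap.mem_graph_iff, mem_graph_ofBounded]; rfl

/-- If the resolvent `c = (1 + x* x)⁻¹` is central and `x` is everywhere defined, hence bounded, on
the range of a projection of central support `1`, then `c ≥ δ > 0`, so that `x` is bounded. -/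
theorem HasFullCentralSupport.exists_eq_ofBounded {M : VonNeumannAlgebra H} {p : H →L[ℂ] H}
    (h : M.HasFullCentralSupport p) (hp : M.IsProj p) {x : H →ₗ.[ℂ] H} (hx : x.IsClosed)
    (hpx : ∀ ξ, p ξ ∈ x.domain) {c : H →L[ℂ] H} (hc : IsGraphResolvent x c)
    (hcM : c ∈ M.centre) : ∃ b : H →L[ℂ] H, x = ofBounded b := by
  have hd : (algMul x (ofBounded p)).domain = ⊤ := by
    refine Submodule.eq_top_iff'.2 fun ξ => ?_
    exact LinearPMap.mem_domain_of_mem_graph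
      (mem_graph_algMul_ofBounded (v := (ξ, x ⟨p ξ, hpx ξ⟩)).2 (x.mem_graph ⟨p ξ, hpx ξ⟩))
  obtain ⟨b, hb⟩ := VonNeumannAlgebra.exists_eq_ofBounded (isClosed_algMul_ofBounded hx p) hd
  have hbx : ∀ ξ, p ξ = ξ → (ξ, b ξ) ∈ x.graph := fun ξ hξ => by
    have : (ξ, b ξ) ∈ (algMul x (ofBounded p)).graph := hb ▸ mem_graph_ofBounded.2 rfl
    rw [mem_graph_algMul_ofBounded] at this
    simpa only [hξ] using this
  set δ : ℝ := (1 + ‖b‖ ^ 2)⁻¹ with hδ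
  have hδ0 : 0 < δ := by positivity
  have hq : 0 ≤ c - (δ : ℂ) • (1 : H →L[ℂ] H) := by
    refine h.nonneg hp ⟨sub_mem hcM.1 (smul_mem _ _ (one_mem _)),
      sub_mem hcM.2 (smul_mem _ _ (one_mem _))⟩ ?_ fun ξ hξ => ?_
    · exact hc.nonneg.isSelfAdjoint.sub (isSelfAdjoint_ofReal_smul_one δ)
    · have h₁ := hc.le_re_inner (hbx ξ hξ) (b.le_opNorm ξ)
      have h₂ : (inner ℂ ((c - (δ : ℂ) • (1 : H →L[ℂ] H)) ξ) ξ).re =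
          (inner ℂ (c ξ) ξ).re - δ * ‖ξ‖ ^ 2 := by
        simp only [sub_apply, smul_apply,
          one_apply_eq_self, inner_sub_left, inner_smul_left, Complex.conj_ofReal,
          inner_self_eq_ofReal, Complex.sub_re, ← Complex.ofReal_mul, Complex.ofReal_re]
      rw [h₂, hδ, sub_nonneg, inv_mul_le_iff₀ (by positivity)]
      exact h₁
  -- The range of `c` is contained in the domain of `x`, so it suffices that `c` is surjective.
  have hu : IsUnit c := by
    refine CStarAlgebra.isUnit_of_le ((δ : ℂ) • (1 : H →L[ℂ] H)) (sub_nonneg.1 hq) ?_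
    refine ⟨ofReal_smul_nonneg hδ0.le zero_le_one, ?_⟩
    exact isUnit_one.smul (Units.mk0 (δ : ℂ) (by exact_mod_cast hδ0.ne'))
  refine VonNeumannAlgebra.exists_eq_ofBounded hx (Submodule.eq_top_iff'.2 fun ξ => ?_)
  obtain ⟨d, hd⟩ := hu.exists_right_inv
  obtain ⟨β, hβ, -⟩ := hc (d ξ)
  have : c (d ξ) = ξ := congrArg (fun b : H →L[ℂ] H => b ξ) hd
  rw [this] at hβ
  exact LinearPMap.mem_domain_of_mem_graph hβ

/-- A closed operator affiliated with `M` that commutes with a self-adjoint subset `F` of `M` whose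
relative commutant is central, and that is everywhere defined on the range of a projection of
central support `1`, is a bounded central element. -/
theorem exists_mem_centre_eq_ofBounded {M : VonNeumannAlgebra H} {F : Set (H →L[ℂ] H)}
    (hstar : ∀ a ∈ F, star a ∈ F)
    (hcomm : ∀ b ∈ M, (∀ a ∈ F, a * b = b * a) → b ∈ M.commutant) {x : H →ₗ.[ℂ] H}
    (hx : x.IsClosed) (hxM : M.Affiliated x) (hinv : ∀ a ∈ F, GraphInvariant a x)
    {p : H →L[ℂ] H} (hp : M.IsProj p) (hpx : ∀ ξ, p ξ ∈ x.domain)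
    (h : M.HasFullCentralSupport p) : ∃ z ∈ M.centre, ofBounded z = x := by
  obtain ⟨c, hc⟩ := exists_isGraphResolvent hx
  have hcM : c ∈ M := by
    rw [← commutant_commutant M, mem_commutant_iff]
    exact fun a ha => hc.commute (hxM.graphInvariant ha) (hxM.graphInvariant (star_mem ha))
  have hcM' : c ∈ M.commutant :=
    hcomm c hcM fun a ha => hc.commute (hinv a ha) (hinv _ (hstar a ha))
  obtain ⟨b, rfl⟩ := h.exists_eq_ofBounded hp hx hpx hc ⟨hcM, hcM'⟩
  have hbM : b ∈ M := by
    rw [← commutant_commutant M, mem_commutant_iff]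
    exact fun a ha => (graphInvariant_ofBounded.1 (hxM.graphInvariant ha)).symm
  exact ⟨b, ⟨hbM, hcomm b hbM fun a ha => (graphInvariant_ofBounded.1 (hinv a ha)).symm⟩, rfl⟩

/-- The common argument for `S(M)` and `S(M, τ)`, which both contain all of `M`. -/
theorem strongCentre_eq_image_centre {M : VonNeumannAlgebra H} {A : Set (H →ₗ.[ℂ] H)}
    (hM : ∀ z, z ∈ M.centre → M.IsFiniteProj z → z = 0)
    (hA : ∀ x ∈ A, x.IsClosed ∧ M.Affiliated x ∧ x.domainᗮ = ⊥ ∧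
      ∃ p, M.IsProj p ∧ (∀ ξ, p ξ ∈ x.domain) ∧ M.IsFiniteProj (1 - p))
    (hMA : ∀ a ∈ M, ofBounded a ∈ A) : strongCentre A = ofBounded '' M.centre := by
  refine Set.Subset.antisymm ?_ ?_
  · rintro y ⟨hy, hcomm⟩
    obtain ⟨hcl, haff, -, p, hp, hpy, hfin⟩ := hA y hy
    exact exists_mem_centre_eq_ofBounded (F := M) (fun a ha => star_mem ha)
      (fun b _ hb => mem_commutant_iff.2 hb) hcl haff
      (fun a ha => graphInvariant_of_strongMul_comm hcl (hcomm _ (hMA a ha))) hp hpy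
      (hasFullCentralSupport_of_isFiniteProj hM hp hfin)
  · rintro _ ⟨z, hz, rfl⟩
    refine ⟨hMA z hz.1, fun x hx => ?_⟩
    obtain ⟨hcl, haff, hd, -⟩ := hA x hx
    exact strongMul_ofBounded_comm hcl haff hd hz.2

/-! ### Dense domains -/

/-- The projection `k` onto the orthogonal complement of the domain of `x` belongs to `M`, and it
lies below `1 - p` for every projection `p` whose range is contained in the domain. -/
theorem exists_orthogonal_proj {M : VonNeumannAlgebra H} {x : H →ₗ.[ℂ] H} (hx : M.Affiliated x) :
    ∃ k, M.IsProj k ∧ (∀ p, M.IsProj p → (∀ ξ, p ξ ∈ x.domain) → k ≤ 1 - p) ∧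
      (k = 0 → x.domainᗮ = ⊥) := by
  have hk : IsStarProjection x.domainᗮ.starProjection := isStarProjection_starProjection
  refine ⟨x.domainᗮ.starProjection, ⟨?_, hk⟩, fun p hp hpx => ?_, fun h => ?_⟩
  · rw [IsStarProjection.mem_iff hk]
    intro a ha
    rw [Submodule.range_starProjection, Module.End.mem_invtSubmodule]
    intro ξ hξ s hs
    have h₁ := LinearPMap.mem_domain_of_mem_graph
      (hx.graphInvariant (star_mem ha) _ _ (x.mem_graph ⟨s, hs⟩))
    have h₂ := hξ _ h₁
    rwa [ContinuousLinearMap.star_eq_adjoint, ContinuousLinearMap.adjoint_inner_left] at h₂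
  · have h₁ : x.domainᗮ.starProjection * p = 0 := by
      ext ξ
      exact (Submodule.starProjection_apply_eq_zero_iff _).2
        (Submodule.le_orthogonal_orthogonal _ (hpx ξ))
    rw [hk.le_iff_mul_eq_left hp.2.one_sub, mul_sub, h₁, mul_one, sub_zero]
  · rw [← Submodule.range_starProjection x.domainᗮ, h]
    exact LinearMap.range_zero

theorem StronglyDense.orthogonal_eq_bot {M : VonNeumannAlgebra H} {x : H →ₗ.[ℂ] H}
    (hx : M.Affiliated x) (h : M.StronglyDense x.domain) : x.domainᗮ = ⊥ := by
  obtain ⟨-, p, hp, -, hlub, hpx, -⟩ := h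
  obtain ⟨k, hk, hkp, hk0⟩ := exists_orthogonal_proj hx
  refine hk0 (le_antisymm ?_ hk.2.nonneg)
  have : (1 : H →L[ℂ] H) ≤ 1 - k := hlub.2 <| by
    rintro _ ⟨n, rfl⟩
    exact le_sub_comm.1 (hkp _ (hp n) (hpx n))
  exact (le_sub_self_iff 1).1 this

/-! ### Traces -/

theorem star_mul_self_mem_posCone {M : VonNeumannAlgebra H} {a : H →L[ℂ] H} (ha : a ∈ M) :
    star a * a ∈ M.posCone :=
  ⟨mul_mem (star_mem ha) ha, star_mul_self_nonneg a⟩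

theorem IsProj.mem_posCone {M : VonNeumannAlgebra H} {p : H →L[ℂ] H} (hp : M.IsProj p) :
    p ∈ M.posCone :=
  ⟨hp.1, hp.2.nonneg⟩

theorem sqrt_mem {N : VonNeumannAlgebra H} {y : H →L[ℂ] H} (hy : y ∈ N) : CFC.sqrt y ∈ N := by
  rw [← commutant_commutant N, mem_commutant_iff]
  intro g hg
  have : Commute y g := mem_commutant_iff.1 hg y hy
  exact (this.cfcₙ_nnreal _).symm

namespace IsFNSTrace

variable {M : VonNeumannAlgebra H} {τ : (H →L[ℂ] H) → ℝ≥0∞}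

theorem map_zero (hτ : M.IsFNSTrace τ) : τ 0 = 0 := by
  simpa using hτ.map_smul 0 0 ⟨zero_mem _, le_rfl⟩

theorem map_ofReal_smul (hτ : M.IsFNSTrace τ) {r : ℝ} (hr : 0 ≤ r) {x : H →L[ℂ] H}
    (hx : x ∈ M.posCone) : τ ((r : ℂ) • x) = ENNReal.ofReal r * τ x :=
  hτ.map_smul ⟨r, hr⟩ x hx |>.trans <| by rw [ENNReal.ofReal, Real.toNNReal_of_nonneg hr]; rfl

theorem mono (hτ : M.IsFNSTrace τ) {x y : H →L[ℂ] H} (hx : x ∈ M.posCone) (hy : y ∈ M.posCone)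
    (h : x ≤ y) : τ x ≤ τ y := by
  have := hτ.map_add x hx (y - x) ⟨sub_mem hy.1 hx.1, sub_nonneg.2 h⟩
  rw [add_sub_cancel] at this
  exact this ▸ le_self_add

theorem isFiniteProj (hτ : M.IsFNSTrace τ) {p : H →L[ℂ] H} (hp : M.IsProj p) (h : τ p < ∞) :
    M.IsFiniteProj p := by
  refine ⟨hp, ?_⟩
  rintro q hq hqp ⟨v, hv, hvp, hvq⟩
  have h₁ : τ q = τ p := by rw [← hvp, ← hvq, hτ.tracial v hv]
  have hd : p - q ∈ M.posCone := ⟨sub_mem hp.1 hq.1, sub_nonneg.2 hqp⟩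
  have h₂ := hτ.map_add q hq.mem_posCone (p - q) hd
  rw [add_sub_cancel, h₁] at h₂
  have h₃ : τ (p - q) = 0 := by
    rw [← ENNReal.add_right_inj h.ne, add_zero]; exact h₂.symm
  exact (sub_eq_zero.1 (hτ.faithful _ hd h₃)).symm

theorem orthogonal_eq_bot (hτ : M.IsFNSTrace τ) {x : H →ₗ.[ℂ] H}
    (hx : M.Affiliated x) (h : M.TraceDense τ x.domain) : x.domainᗮ = ⊥ := by
  obtain ⟨k, hk, hkp, hk0⟩ := exists_orthogonal_proj hx
  refine hk0 (hτ.faithful k hk.mem_posCone ?_)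
  by_contra hne
  obtain ⟨ε, hε, hεk⟩ := ENNReal.lt_iff_exists_nnreal_btwn.1 (pos_iff_ne_zero.2 hne)
  obtain ⟨p, hp, hpx, hpτ⟩ := h.2 ε (by exact_mod_cast hε)
  rw [ENNReal.ofReal_coe_nnreal] at hpτ
  exact absurd (hτ.mono hk.mem_posCone hp.one_sub.mem_posCone (hkp p hp hpx))
    (not_le.2 (hpτ.trans hεk))

/-- Chebyshev's inequality: if `a ≥ 0` has finite trace, then outside the spectral projection
`1 - p` of `a` for `(ε, ∞)`, which has finite trace, `a` is bounded by `ε`. Here `p` is the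
projection onto the kernel of `(a - ε)⁺`. -/
theorem exists_proj_norm_mul_le (hτ : M.IsFNSTrace τ) {a : H →L[ℂ] H} (ha : a ∈ M.posCone)
    (haτ : τ a < ∞) {ε : ℝ} (hε : 0 < ε) :
    ∃ p, M.IsProj p ∧ τ (1 - p) < ∞ ∧ ‖a * p‖ ≤ ε := by
  obtain ⟨e, he⟩ : ∃ e : H →L[ℂ] H, e = (ε : ℂ) • 1 := ⟨_, rfl⟩
  have heM : e ∈ M := he ▸ smul_mem M _ (one_mem M)
  have hes : IsSelfAdjoint e := he ▸ isSelfAdjoint_ofReal_smul_one ε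
  obtain ⟨s, n, hsM, hs, hn, hsn, hdec⟩ : ∃ s n : H →L[ℂ] H,
      s ∈ M ∧ 0 ≤ s ∧ 0 ≤ n ∧ s * n = 0 ∧ s - n = a - e :=
    ⟨(a - e)⁺, (a - e)⁻, posPart_mem (sub_mem ha.1 heM), CFC.posPart_nonneg _,
      CFC.negPart_nonneg _, CFC.posPart_mul_negPart _,
      CFC.posPart_sub_negPart _ (ha.2.isSelfAdjoint.sub hes)⟩
  obtain ⟨k, hk, hker, hkmem⟩ := exists_ker_proj s
  have hkM : M.IsProj k := ⟨hkmem M hsM, hk⟩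
  have hkk : k * k = k := hk.isIdempotentElem
  have hsk : s * k = 0 := by
    ext ξ
    exact (hker _).1 (congrArg (fun b : H →L[ℂ] H => b ξ) hkk)
  have hkn : k * n = n := by
    ext ξ
    exact (hker _).2 (congrArg (fun b : H →L[ℂ] H => b ξ) hsn)
  have hnk : n * k = n := by
    have := congrArg star hkn
    rwa [star_mul, hk.isSelfAdjoint.star_eq, hn.isSelfAdjoint.star_eq] at this
  have hdec' : a = e + s - n := by rw [add_sub_assoc, hdec]; abel
  have hek : e * k = (ε : ℂ) • k := by rw [he, smul_mul_assoc, one_mul]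
  have hak : a * k = (ε : ℂ) • k - n := by
    rw [hdec', sub_mul, add_mul, hsk, hnk, hek, add_zero]
  have hkak : k * a * k = a * k := by
    rw [mul_assoc, hak, mul_sub, hkn, mul_smul_comm, hkk]
  have hak0 : 0 ≤ a * k := by
    rw [← hkak]
    have := star_left_conjugate_nonneg ha.2 k
    rwa [hk.isSelfAdjoint.star_eq] at this
  have hr : M.IsProj (1 - k) := hkM.one_sub
  refine ⟨k, hkM, ?_, ?_⟩
  · have hle : (ε : ℂ) • (1 - k) ≤ a := by
      have h₀ : a - (ε : ℂ) • (1 - k) = a * k + s := by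
        rw [hak, smul_sub, ← he, sub_eq_iff_eq_add, hdec']
        abel
      have h₁ : 0 ≤ a * k + s := add_nonneg hak0 hs
      exact sub_nonneg.1 (h₀ ▸ h₁)
    have hmem : (ε : ℂ) • (1 - k) ∈ M.posCone :=
      ⟨smul_mem M _ hr.1, ofReal_smul_nonneg hε.le hr.2.nonneg⟩
    have h₁ := hτ.mono hmem ha hle
    rw [hτ.map_ofReal_smul hε.le hr.mem_posCone] at h₁
    exact ENNReal.lt_top_of_mul_ne_top_right (h₁.trans_lt haτ).ne
      (ENNReal.ofReal_pos.2 hε).ne'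
  · have h₀ : (ε : ℂ) • (1 : H →L[ℂ] H) - a * k = (ε : ℂ) • (1 - k) + n := by
      rw [hak, smul_sub]; abel
    have h₁ : 0 ≤ (ε : ℂ) • (1 - k) + n :=
      add_nonneg (ofReal_smul_nonneg hε.le hr.2.nonneg) hn
    have h₂ : a * k ≤ algebraMap ℝ (H →L[ℂ] H) ε := by
      rw [Algebra.algebraMap_eq_smul_one, ← Complex.coe_smul]
      exact sub_nonneg.1 (h₀ ▸ h₁)
    exact (CStarAlgebra.norm_le_iff_le_algebraMap _ hε.le hak0).2 h₂

/-! ### The Hilbert–Schmidt ideal of a trace -/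

theorem traceDense_top (hτ : M.IsFNSTrace τ) : M.TraceDense τ ⊤ := by
  refine ⟨fun _ _ _ _ _ => trivial, fun ε hε => ⟨1, ⟨one_mem _, .one _⟩, fun _ => trivial, ?_⟩⟩
  rw [sub_self, hτ.map_zero]
  exact ENNReal.ofReal_pos.2 hε

theorem ofBounded_mem_traceMeasurableOps (hτ : M.IsFNSTrace τ) {a : H →L[ℂ] H} (ha : a ∈ M) :
    ofBounded a ∈ M.traceMeasurableOps τ :=
  ⟨isClosed_ofBounded a, affiliated_ofBounded ha, hτ.traceDense_top⟩

/-- The Hilbert–Schmidt operators of `M` with respect to the trace `τ`. -/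
def hilbertSchmidt (M : VonNeumannAlgebra H) (τ : (H →L[ℂ] H) → ℝ≥0∞) : Set (H →L[ℂ] H) :=
  {a | a ∈ M ∧ τ (star a * a) < ∞}

theorem star_mem_hilbertSchmidt (hτ : M.IsFNSTrace τ) {a : H →L[ℂ] H}
    (ha : a ∈ hilbertSchmidt M τ) : star a ∈ hilbertSchmidt M τ := by
  refine ⟨star_mem ha.1, ?_⟩
  rw [star_star, ← hτ.tracial a ha.1]
  exact ha.2

theorem mul_mem_hilbertSchmidt (hτ : M.IsFNSTrace τ) {g a : H →L[ℂ] H} (hg : g ∈ M)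
    (ha : a ∈ hilbertSchmidt M τ) : g * a ∈ hilbertSchmidt M τ := by
  refine ⟨mul_mem hg ha.1, ?_⟩
  have h₁ : star (g * a) * (g * a) ≤ ((‖g‖ ^ 2 : ℝ) : ℂ) • (star a * a) := by
    have := star_left_conjugate_le_conjugate
      (CStarAlgebra.star_mul_le_algebraMap_norm_sq (a := g)) a
    rw [Algebra.algebraMap_eq_smul_one, mul_smul_comm, smul_mul_assoc, mul_one] at this
    rw [Complex.coe_smul, star_mul]
    simpa only [mul_assoc] using this
  have hp := star_mul_self_mem_posCone ha.1
  have h₂ := hτ.mono (star_mul_self_mem_posCone (mul_mem hg ha.1))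
    ⟨smul_mem M _ hp.1, ofReal_smul_nonneg (sq_nonneg ‖g‖) hp.2⟩ h₁
  rw [hτ.map_ofReal_smul (sq_nonneg _) hp] at h₂
  exact h₂.trans_lt (ENNReal.mul_lt_top ENNReal.ofReal_lt_top ha.2)

theorem ofBounded_mem_traceCompactOps (hτ : M.IsFNSTrace τ) {a : H →L[ℂ] H}
    (ha : a ∈ hilbertSchmidt M τ) : ofBounded a ∈ M.traceCompactOps τ := by
  refine ⟨hτ.ofBounded_mem_traceMeasurableOps ha.1, fun ε hε => ?_⟩
  obtain ⟨p, hp, hpτ, hle⟩ := hτ.exists_proj_norm_mul_le (star_mul_self_mem_posCone ha.1) ha.2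
    (ε := (ε / 2) ^ 2) (by positivity)
  refine ⟨p, hp, hpτ, a * p, mul_mem ha.1 hp.1, strongMul_ofBounded_ofBounded a p, ?_⟩
  have h₁ : ‖a * p‖ ^ 2 ≤ (ε / 2) ^ 2 := by
    rw [sq, ← CStarRing.norm_star_mul_self, star_mul, hp.2.isSelfAdjoint.star_eq]
    calc ‖p * star a * (a * p)‖ = ‖p * (star a * a * p)‖ := by simp only [mul_assoc]
      _ ≤ ‖p‖ * ‖star a * a * p‖ := norm_mul_le _ _
      _ ≤ 1 * (ε / 2) ^ 2 := by gcongr; exact hp.2.norm_le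
      _ = _ := one_mul _
  linarith [le_of_sq_le_sq h₁ (by positivity)]

/-- By semi-finiteness of `τ`, the Hilbert–Schmidt operators act nondegenerately: a nonzero
`t* t` majorizes some `y ≠ 0` of finite trace, and `y` has a Hilbert–Schmidt square root. -/
theorem eq_zero_of_mul_hilbertSchmidt (hτ : M.IsFNSTrace τ) {t : H →L[ℂ] H} (ht : t ∈ M)
    (h : ∀ a ∈ hilbertSchmidt M τ, t * a = 0) : t = 0 := by
  by_contra hne
  obtain ⟨y, hy, hy0, hyt, hyτ⟩ := hτ.semifinite _ (star_mul_self_mem_posCone ht)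
    (fun h0 => hne (CStarRing.star_mul_self_eq_zero_iff t |>.1 h0))
  have hsq : CFC.sqrt y * CFC.sqrt y = y := CFC.sqrt_mul_sqrt_self y hy.2
  have hss : star (CFC.sqrt y) = CFC.sqrt y := (CFC.sqrt_nonneg y).isSelfAdjoint
  have hts : t * CFC.sqrt y = 0 := h _ ⟨sqrt_mem hy.1, by rwa [hss, hsq]⟩
  have hty : t * y = 0 := by rw [← hsq, ← mul_assoc, hts, zero_mul]
  have hys : star y = y := hy.2.isSelfAdjoint
  have hyy : y * y = 0 := by
    ext ξ
    change y (y ξ) = 0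
    refine apply_eq_zero_of_re_inner_nonpos hy.2 ?_
    have h₁ := ((ContinuousLinearMap.le_def _ _).1 hyt).re_inner_nonneg_left (y ξ)
    have h₂ : t (y ξ) = 0 := congrArg (fun b : H →L[ℂ] H => b ξ) hty
    rw [sub_apply, mul_apply_eq_comp, h₂, _root_.map_zero, zero_sub, inner_neg_left, _root_.map_neg,
      RCLike.re_eq_complex_re] at h₁
    linarith
  exact hy0 (CStarRing.star_mul_self_eq_zero_iff y |>.1 (by rw [hys, hyy]))

/-- The relative commutant of the Hilbert–Schmidt operators in `M` is the centre, because they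
form a nondegenerate left ideal of `M`. -/
theorem mem_commutant_of_commute_hilbertSchmidt (hτ : M.IsFNSTrace τ) {b : H →L[ℂ] H}
    (hb : b ∈ M) (h : ∀ a ∈ hilbertSchmidt M τ, a * b = b * a) : b ∈ M.commutant := by
  refine mem_commutant_iff.2 fun g hg => sub_eq_zero.1 ?_
  refine hτ.eq_zero_of_mul_hilbertSchmidt (sub_mem (mul_mem hg hb) (mul_mem hb hg)) fun a ha => ?_
  rw [sub_mul, mul_assoc, ← h a ha, ← mul_assoc, h _ (hτ.mul_mem_hilbertSchmidt hg ha), mul_assoc,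
    sub_self]

/-! ### The centres -/

theorem exists_isFiniteProj_of_traceDense (hτ : M.IsFNSTrace τ) {D : Submodule ℂ H}
    (h : M.TraceDense τ D) :
    ∃ p, M.IsProj p ∧ (∀ ξ, p ξ ∈ D) ∧ M.IsFiniteProj (1 - p) := by
  obtain ⟨p, hp, hpD, hpτ⟩ := h.2 1 one_pos
  exact ⟨p, hp, hpD, hτ.isFiniteProj hp.one_sub (hpτ.trans ENNReal.ofReal_lt_top)⟩

theorem strongCentre_traceMeasurableOps (hτ : M.IsFNSTrace τ)
    (hM : ∀ z, z ∈ M.centre → M.IsFiniteProj z → z = 0) :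
    strongCentre (M.traceMeasurableOps τ) = ofBounded '' M.centre :=
  strongCentre_eq_image_centre hM
    (fun _ hx => ⟨hx.1, hx.2.1, hτ.orthogonal_eq_bot hx.2.1 hx.2.2,
      hτ.exists_isFiniteProj_of_traceDense hx.2.2⟩)
    (fun _ ha => hτ.ofBounded_mem_traceMeasurableOps ha)

/-- A central `τ`-compact operator is zero: for every `ε` its norm is less than `ε` on the range
of a projection of central support `1`, hence at most `ε` everywhere. -/
theorem eq_zero_of_mem_centre (hτ : M.IsFNSTrace τ)
    (hM : ∀ z, z ∈ M.centre → M.IsFiniteProj z → z = 0) {z : H →L[ℂ] H} (hz : z ∈ M.centre)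
    (hzc : ofBounded z ∈ M.traceCompactOps τ) : z = 0 := by
  have hle : ∀ ε : ℝ, 0 < ε → ‖z‖ ≤ ε := fun ε hε => by
    obtain ⟨p, hp, hpτ, a, -, hza, ha⟩ := hzc.2 ε hε
    rw [strongMul_ofBounded_ofBounded] at hza
    have hzp : z * p = a := ofBounded_injective hza
    have hfull := hasFullCentralSupport_of_isFiniteProj hM hp (hτ.isFiniteProj hp.one_sub hpτ)
    obtain ⟨q, hqdef⟩ : ∃ q : H →L[ℂ] H, q = ((ε ^ 2 : ℝ) : ℂ) • 1 - star z * z := ⟨_, rfl⟩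
    have hre : ∀ ξ, (inner ℂ (q ξ) ξ).re = ε ^ 2 * ‖ξ‖ ^ 2 - ‖z ξ‖ ^ 2 := fun ξ => by
      rw [hqdef, sub_apply, smul_apply, one_apply_eq_self, mul_apply_eq_comp,
        ContinuousLinearMap.star_eq_adjoint, inner_sub_left, inner_smul_left,
        Complex.conj_ofReal, ContinuousLinearMap.adjoint_inner_left, inner_self_eq_ofReal,
        inner_self_eq_ofReal, ← Complex.ofReal_mul, ← Complex.ofReal_sub, Complex.ofReal_re]
    have hqmem : ∀ N : VonNeumannAlgebra H, z ∈ N → q ∈ N := fun N hzN =>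
      hqdef ▸ sub_mem (smul_mem N _ (one_mem N)) (mul_mem (star_mem hzN) hzN)
    have hqs : IsSelfAdjoint q :=
      hqdef ▸ (isSelfAdjoint_ofReal_smul_one _).sub
        (IsSelfAdjoint.star_mul_self z)
    have hq : 0 ≤ q := hfull.nonneg hp ⟨hqmem _ hz.1, hqmem _ hz.2⟩ hqs fun ξ hξ => by
      have h₁ : z ξ = a ξ := by rw [← hzp, mul_apply_eq_comp, hξ]
      rw [hre, sub_nonneg, ← mul_pow, h₁]
      gcongr
      exact (a.le_opNorm ξ).trans (by gcongr)
    refine z.opNorm_le_bound hε.le fun ξ => ?_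
    have h₁ : 0 ≤ (inner ℂ (q ξ) ξ).re :=
      ((ContinuousLinearMap.nonneg_iff_isPositive _).1 hq).re_inner_nonneg_left ξ
    rw [hre, sub_nonneg, ← mul_pow] at h₁
    exact le_of_sq_le_sq h₁ (by positivity)
  exact norm_le_zero_iff.1 (le_of_forall_pos_le_add fun ε hε => by simpa using hle ε hε)

theorem strongCentre_traceCompactOps (hτ : M.IsFNSTrace τ)
    (hM : ∀ z, z ∈ M.centre → M.IsFiniteProj z → z = 0) :
    strongCentre (M.traceCompactOps τ) = {0} := by
  refine Set.Subset.antisymm ?_ (Set.singleton_subset_iff.2 ⟨?_, fun x hx => ?_⟩)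
  · rintro y ⟨hy, hcomm⟩
    obtain ⟨p, hp, hpy, hfin⟩ := hτ.exists_isFiniteProj_of_traceDense hy.1.2.2
    obtain ⟨z, hz, rfl⟩ := exists_mem_centre_eq_ofBounded (F := hilbertSchmidt M τ)
      (fun a ha => hτ.star_mem_hilbertSchmidt ha)
      (fun b hb h => hτ.mem_commutant_of_commute_hilbertSchmidt hb h) hy.1.1 hy.1.2.1
      (fun a ha => graphInvariant_of_strongMul_comm hy.1.1
        (hcomm _ (hτ.ofBounded_mem_traceCompactOps ha)))
      hp hpy (hasFullCentralSupport_of_isFiniteProj hM hp hfin)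
    rw [Set.mem_singleton_iff, hτ.eq_zero_of_mem_centre hM hz hy, ofBounded_zero]
  · rw [← ofBounded_zero]
    refine hτ.ofBounded_mem_traceCompactOps ⟨zero_mem _, ?_⟩
    rw [mul_zero, hτ.map_zero]
    exact ENNReal.zero_lt_top
  · rw [← ofBounded_zero]
    exact strongMul_ofBounded_comm hx.1.1 hx.1.2.1 (hτ.orthogonal_eq_bot hx.1.2.1 hx.1.2.2)
      (zero_mem _)

end IsFNSTrace

theorem strongCentre_measurableOps {M : VonNeumannAlgebra H}
    (hM : ∀ z, z ∈ M.centre → M.IsFiniteProj z → z = 0) :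
    strongCentre M.measurableOps = ofBounded '' M.centre := by
  refine strongCentre_eq_image_centre hM (fun x hx => ⟨hx.1, hx.2.1,
    hx.2.2.orthogonal_eq_bot hx.2.1, ?_⟩) fun a ha => ⟨isClosed_ofBounded a,
      affiliated_ofBounded ha, fun _ _ _ _ _ => trivial, fun _ => 1,
      fun _ => ⟨one_mem _, .one _⟩, monotone_const, ?_, fun _ _ => trivial, fun _ => ?_⟩
  · obtain ⟨-, p, hp, -, -, hpx, hfin⟩ := hx.2.2
    exact ⟨p 0, hp 0, hpx 0, hfin 0⟩
  · rw [Set.range_const]; exact isLUB_singleton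
  · rw [sub_self]; exact isFiniteProj_zero M

end VonNeumannAlgebra

theorem lemma3p6 {H : Type*} [NormedAddCommGroup H] [InnerProductSpace ℂ H] [CompleteSpace H]
    (M : VonNeumannAlgebra H) (hM : M.IsTypeIInfty) :
    VonNeumannAlgebra.strongCentre M.measurableOps =
        VonNeumannAlgebra.ofBounded '' M.centre ∧
      ∀ τ : (H →L[ℂ] H) → ENNReal, M.IsFNSTrace τ →
        VonNeumannAlgebra.strongCentre (M.traceMeasurableOps τ) =
            VonNeumannAlgebra.ofBounded '' M.centre ∧
          VonNeumannAlgebra.strongCentre (M.traceCompactOps τ) = {0} :=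
  ⟨VonNeumannAlgebra.strongCentre_measurableOps hM.2, fun _ hτ =>
    ⟨hτ.strongCentre_traceMeasurableOps hM.2, hτ.strongCentre_traceCompactOps hM.2⟩⟩
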